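/- Let $d \ge 2$ be an integer. Every finite simple $2d$-regular graph $G$, connected or not, admits an antimagic orientation: the edges of $G$ can be oriented, each in exactly one of its two directions, so that the resulting digraph $D$ with arc set $A(D)$ has a bijection $c : A(D) \to \{1, 2, \dots, |A(D)|\}$ for which the vertex-sums $$S(u) = \sum_{\text{arcs } a \text{ entering } u} c(a) \; - \sum_{\text{arcs } a \text{ leaving } u} c(a), \qquad u \in V(G),$$ are pairwise distinct. -/

import Mathlib

namespace Digraph

/-- The set of arcs `A(D)`; the arc from `u` to `v` is the pair `(u, v)`. -/
def arcSet {V : Type*} (D : Digraph V) : Set (V × V) :=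
  {a | D.Adj a.1 a.2}

open Classical in
/-- The vertex-sum of `u`: the sum of the labels of the arcs entering `u` minus the sum of the
labels of the arcs leaving `u`. -/
noncomputable def vertexSum {V : Type*} [Fintype V] (D : Digraph V) (c : V × V → ℕ) (u : V) : ℤ :=
  (∑ w ∈ Finset.univ.filter (fun w => D.Adj w u), (c (w, u) : ℤ)) -
    (∑ w ∈ Finset.univ.filter (fun w => D.Adj u w), (c (u, w) : ℤ))

/-- `c` restricts to a bijection from `A(D)` onto `{1, …, |A(D)|}` for which distinct vertices have
distinct vertex-sums. The values of `c` at pairs that are not arcs play no role. -/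
def IsAntimagicLabeling {V : Type*} [Fintype V] (D : Digraph V) (c : V × V → ℕ) : Prop :=
  Set.BijOn c D.arcSet (Set.Icc 1 D.arcSet.ncard) ∧ Function.Injective (D.vertexSum c)

/-- A digraph is antimagic if it has an antimagic labeling. -/
def IsAntimagic {V : Type*} [Fintype V] (D : Digraph V) : Prop :=
  ∃ c : V × V → ℕ, D.IsAntimagicLabeling c

end Digraph

namespace SimpleGraph

/-- `D` is an orientation of `G`: each edge of `G` is given exactly one of its two directions, and
`D` has no other arcs. -/
def IsOrientation {V : Type*} (G : SimpleGraph V) (D : Digraph V) : Prop :=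
  (∀ u v, G.Adj u v ↔ D.Adj u v ∨ D.Adj v u) ∧ ∀ u v, D.Adj u v → ¬ D.Adj v u

/-- `G` has an antimagic orientation if some orientation of `G` is antimagic. -/
def HasAntimagicOrientation {V : Type*} [Fintype V] (G : SimpleGraph V) : Prop :=
  ∃ D : Digraph V, G.IsOrientation D ∧ D.IsAntimagic

end SimpleGraph

/-! Take an Euler tour of each component, mark one visit to each vertex, including the first and
last positions of each tour, and cut the tours into sections at the marks. Orient the sections of a
tour alternately forward and backward, and number the edges of a section consecutively along its
direction. Every unmarked visit then contributes -1. Each vertex has `d` visits, so its sum is the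
contribution of its marked visit minus `d - 1` (`sum_visits_visitSum`), and only marked visits need
comparing.

Where two sections of opposite direction meet, both edges enter or both leave: the contribution is
plus or minus a sum of two labels. The sections are ordered so that, of two such joints with the
same sign, one has the smaller labels under a suitable pairing (`IsJoint.sectionKey_lt`).

The exception is the start of a tour with an odd number of sections, which contributes a positive
difference, last label minus first. It is less than every positive joint sum
(`visitSum_ne_visitSum_zero`). These differences strictly decrease with the tour index, because
first sections have at least two edges and last sections exactly one (`visitSum_zero_lt_of_lt`).
Here `d ≥ 2` enters: a second visit lets position 1 stay unmarked. -/

namespace SimpleGraph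

/-! ### Euler tours of the components -/

/-- A family of closed walks, one for each `i : ι`, that are pairwise vertex-disjoint and together
traverse every edge of `G` exactly once. The `i`-th walk visits `vert i 0, …, vert i (len i)`. -/
structure EulerTours {V : Type*} (G : SimpleGraph V) (ι : Type*) where
  len : ι → ℕ
  vert : ι → ℕ → V
  len_pos : ∀ i, 0 < len i
  adj : ∀ i t, t < len i → G.Adj (vert i t) (vert i (t + 1))
  closed : ∀ i, vert i (len i) = vert i 0
  edge_inj : ∀ i j t t', t < len i → t' < len j →
    s(vert i t, vert i (t + 1)) = s(vert j t', vert j (t' + 1)) → i = j ∧ t = t'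
  edge_surj : ∀ x y, G.Adj x y → ∃ i t, t < len i ∧ s(vert i t, vert i (t + 1)) = s(x, y)
  eq_of_vert_eq : ∀ i j t t', vert i t = vert j t' → i = j

theorem Walk.mem_support_of_reachable {V : Type*} {G : SimpleGraph V} {u : V} {p : G.Walk u u}
    (h : ∀ y ∈ p.support, ∀ z, G.Adj y z → s(y, z) ∈ p.edges) {y : V} (hy : G.Reachable u y) :
    y ∈ p.support := by
  obtain ⟨q⟩ := hy
  suffices ∀ (a b : V) (q : G.Walk a b), a ∈ p.support → b ∈ p.support from
    this u y q p.start_mem_support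
  intro a b q
  induction q with
  | nil => exact id
  | cons hadj q ih => exact fun ha => ih (p.snd_mem_support_of_mem_edges (h _ ha _ hadj))

section Tours

variable {V : Type*} [Fintype V] {G : SimpleGraph V} [DecidableRel G.Adj]

/-- An open trail uses an odd number of edges at its start, so it cannot use all of an even number.
-/
theorem Walk.IsTrail.exists_adj_notMem_edges (hG : ∀ v, Even (G.degree v)) {u v : V}
    {p : G.Walk u v} (hp : p.IsTrail) (huv : u ≠ v) : ∃ x, G.Adj u x ∧ s(u, x) ∉ p.edges := by
  classical
  by_contra! hcon
  have h := (hp.even_countP_edges_iff u).not.2 (by simp [huv])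
  apply h
  have : p.edges.countP (fun e => u ∈ e) = G.degree u := by
    rw [← card_incidenceFinset_eq_degree, List.countP_eq_length_filter,
      ← List.toFinset_card_of_nodup (hp.edges_nodup.filter _)]
    congr 1
    ext e
    simp only [List.mem_toFinset, List.mem_filter, decide_eq_true_eq, mem_incidenceFinset,
      incidenceSet, Set.mem_sep_iff]
    constructor
    · rintro ⟨h1, h2⟩
      exact ⟨p.edges_subset_edgeSet h1, h2⟩
    · rintro ⟨h1, h2⟩
      obtain ⟨x, rfl⟩ := Sym2.mem_iff_exists.1 h2
      exact ⟨hcon x h1, h2⟩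
  rw [this]
  exact hG u

/-- Take a longest trail. If open, it extends at its start; if closed with an unused edge at one of
its vertices, it extends after rotation to that vertex. -/
theorem exists_isTrail_forall_adj_mem_edges (hG : ∀ v, Even (G.degree v)) (x : V) :
    ∃ (u : V) (p : G.Walk u u), G.Reachable x u ∧ p.IsTrail ∧
      ∀ y ∈ p.support, ∀ z, G.Adj y z → s(y, z) ∈ p.edges := by
  classical
  let Q : ℕ → Prop := fun n => ∃ (u v : V) (p : G.Walk u v), G.Reachable x u ∧ p.IsTrail ∧
    p.length = n
  have hQ0 : Q 0 := ⟨x, x, Walk.nil, Reachable.refl x, Walk.IsTrail.nil, rfl⟩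
  obtain ⟨u, v, p, hxu, hp, hlen⟩ := Nat.findGreatest_spec (P := Q)
    (Nat.zero_le G.edgeFinset.card) hQ0
  have hmax : ∀ (u' v' : V) (q : G.Walk u' v'), G.Reachable x u' → q.IsTrail →
      q.length ≤ p.length := by
    intro u' v' q h1 h2
    rw [hlen]
    exact Nat.le_findGreatest h2.length_le_card_edgeFinset ⟨u', v', q, h1, h2, rfl⟩
  have huv : u = v := by
    by_contra huv
    obtain ⟨y, hy, hye⟩ := hp.exists_adj_notMem_edges hG huv
    have := hmax y v (Walk.cons hy.symm p) (hxu.trans hy.reachable)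
      (by rw [Walk.isTrail_cons]; exact ⟨hp, by rwa [Sym2.eq_swap]⟩)
    simp at this
  subst huv
  refine ⟨u, p, hxu, hp, fun y hy z hyz => ?_⟩
  by_contra hne
  have hxy : G.Reachable x y := hxu.trans (p.takeUntil y hy).reachable
  have := hmax z y (Walk.cons hyz.symm (p.rotate y hy)) (hxy.trans hyz.reachable)
    (by
      rw [Walk.isTrail_cons]
      refine ⟨hp.rotate hy, ?_⟩
      rwa [Sym2.eq_swap, (p.rotate_edges y hy).mem_iff])
  simp at this

theorem exists_eulerTours (hG : ∀ v, Even (G.degree v)) (hpos : ∀ v, 0 < G.degree v) :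
    Nonempty (EulerTours G G.ConnectedComponent) := by
  classical
  have h := fun C : G.ConnectedComponent => exists_isTrail_forall_adj_mem_edges hG C.out
  choose u p hr ht hfull using h
  have hcomp : ∀ C t, G.connectedComponentMk ((p C).getVert t) = C := by
    intro C t
    have h1 : G.Reachable (u C) ((p C).getVert t) :=
      ((p C).takeUntil _ ((p C).getVert_mem_support t)).reachable
    have h2 := (hr C).trans h1
    calc _ = G.connectedComponentMk C.out := (ConnectedComponent.eq.2 h2).symm
      _ = C := Quot.out_eq C
  refine ⟨⟨fun C => (p C).length, fun C => (p C).getVert, ?_, ?_, ?_, ?_, ?_, ?_⟩⟩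
  · intro C
    obtain ⟨z, hz⟩ := (G.degree_pos_iff_exists_adj _).1 (hpos (u C))
    have := hfull C _ (p C).start_mem_support z hz
    rw [← Walk.length_edges]
    exact List.length_pos_of_mem this
  · exact fun C t h => (p C).adj_getVert_succ h
  · simp
  · intro C C' t t' h h' he
    have hC : C = C' := by
      have : (p C).getVert t ∈ s((p C').getVert t', (p C').getVert (t' + 1)) := by
        rw [← he]; simp
      rw [Sym2.mem_iff] at this
      rw [← hcomp C t]
      rcases this with h | h <;> rw [h, hcomp]
    subst hC
    refine ⟨rfl, ?_⟩
    rw [← Walk.length_edges] at h h'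
    rw [← Walk.getElem_edges h, ← Walk.getElem_edges h'] at he
    exact (ht C).edges_nodup.getElem_inj_iff.1 he
  · intro x y hxy
    set C := G.connectedComponentMk x with hC
    have hx : G.Reachable (u C) x := by
      refine (hr C).symm.trans (ConnectedComponent.eq.1 ?_)
      exact (Quot.out_eq C).trans hC
    have := hfull C x (Walk.mem_support_of_reachable (hfull C) hx) y hxy
    obtain ⟨t, h, he⟩ := List.mem_iff_getElem.1 this
    refine ⟨C, t, by simpa using h, ?_⟩
    rw [← Walk.getElem_edges h, he]
  · intro C C' t t' h
    rw [← hcomp C t, h, hcomp]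

end Tours

end SimpleGraph

/-! ### From labelled arcs to an antimagic orientation -/

theorem SimpleGraph.hasAntimagicOrientation_of_arcs {V α : Type*} [Fintype V] [DecidableEq V]
    (G : SimpleGraph V) (A : Finset α) (tl hd : α → V)
    (hadj : ∀ e ∈ A, G.Adj (tl e) (hd e))
    (hinj : ∀ e ∈ A, ∀ e' ∈ A, s(tl e, hd e) = s(tl e', hd e') → e = e')
    (hsurj : ∀ x y, G.Adj x y → ∃ e ∈ A, s(tl e, hd e) = s(x, y))
    (c : α → ℕ) (hc : Set.InjOn c A) (hc1 : ∀ e ∈ A, c e ∈ Set.Icc 1 A.card)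
    (hS : Function.Injective fun u => ∑ e ∈ A,
      ((if hd e = u then (c e : ℤ) else 0) - if tl e = u then (c e : ℤ) else 0)) :
    G.HasAntimagicOrientation := by
  classical
  obtain ⟨D, hD⟩ : ∃ D : Digraph V, ∀ x y, D.Adj x y ↔ ∃ e ∈ A, tl e = x ∧ hd e = y :=
    ⟨⟨fun x y => ∃ e ∈ A, tl e = x ∧ hd e = y⟩, fun _ _ => Iff.rfl⟩
  let c' : V × V → ℕ := fun a => if h : ∃ e ∈ A, tl e = a.1 ∧ hd e = a.2 then c h.choose else 0
  have hc' : ∀ e ∈ A, c' (tl e, hd e) = c e := by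
    intro e he
    have h : ∃ e' ∈ A, tl e' = tl e ∧ hd e' = hd e := ⟨e, he, rfl, rfl⟩
    simp only [c', dif_pos h]
    rw [hinj _ h.choose_spec.1 e he (by rw [h.choose_spec.2.1, h.choose_spec.2.2])]
  have hpair : Set.InjOn (fun e => (tl e, hd e)) (A : Set α) := by
    intro e he e' he' h
    simp only [Prod.mk.injEq] at h
    exact hinj e he e' he' (by rw [h.1, h.2])
  have harc : D.arcSet = (fun e => (tl e, hd e)) '' (A : Set α) := by
    ext ⟨x, y⟩
    simp [Digraph.arcSet, hD]
  refine ⟨D, ⟨fun u v => ⟨fun h => ?_, ?_⟩, ?_⟩, c', ⟨?_, ?_, ?_⟩, ?_⟩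
  · obtain ⟨e, he, h⟩ := hsurj u v h
    rcases Sym2.eq_iff.1 h with h | h
    · exact Or.inl ((hD _ _).2 ⟨e, he, h⟩)
    · exact Or.inr ((hD _ _).2 ⟨e, he, h⟩)
  · simp only [hD]
    rintro (⟨e, he, rfl, rfl⟩ | ⟨e, he, rfl, rfl⟩)
    · exact hadj e he
    · exact (hadj e he).symm
  · simp only [hD]
    rintro u v ⟨e, he, rfl, rfl⟩ ⟨e', he', h1, h2⟩
    have := hinj e he e' he' (by rw [h1, h2, Sym2.eq_swap])
    subst this
    exact (hadj e he).ne h1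
  · rw [harc, hpair.ncard_image, Set.ncard_coe_finset]
    rintro _ ⟨e, he, rfl⟩
    simpa only [hc' e he] using hc1 e he
  · rw [harc]
    rintro _ ⟨e, he, rfl⟩ _ ⟨e', he', rfl⟩ h
    simp only [hc' e he, hc' e' he'] at h
    rw [hc he he' h]
  · rw [harc, hpair.ncard_image, Set.ncard_coe_finset]
    -- An injection into a set of the same size is onto.
    have himg : A.image c = Finset.Icc 1 A.card := by
      apply Finset.eq_of_subset_of_card_le
      · intro k hk
        obtain ⟨e, he, rfl⟩ := Finset.mem_image.1 hk
        simpa using hc1 e he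
      · rw [Finset.card_image_of_injOn hc]; simp
    intro k hk
    rw [← Finset.coe_Icc, ← himg] at hk
    obtain ⟨e, he, rfl⟩ := Finset.mem_image.1 hk
    exact ⟨_, ⟨e, he, rfl⟩, hc' e he⟩
  · convert! hS using 1
    funext u
    unfold Digraph.vertexSum
    rw [Finset.sum_sub_distrib, ← Finset.sum_filter, ← Finset.sum_filter]
    congr 1
    · symm
      apply Finset.sum_bij (fun e _ => tl e)
      · intro e he
        rw [Finset.mem_filter] at he
        simpa [hD] using ⟨e, he.1, rfl, he.2⟩
      · intro e he e' he' h
        rw [Finset.mem_filter] at he he'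
        exact hinj e he.1 e' he'.1 (by rw [h, he.2, he'.2])
      · intro w hw
        rw [Finset.mem_filter] at hw
        obtain ⟨e, he, rfl, rfl⟩ := (hD _ _).1 hw.2
        exact ⟨e, by simpa using he, rfl⟩
      · intro e he
        rw [Finset.mem_filter] at he
        rw [← hc' e he.1, he.2]
    · symm
      apply Finset.sum_bij (fun e _ => hd e)
      · intro e he
        rw [Finset.mem_filter] at he
        simpa [hD] using ⟨e, he.1, he.2, rfl⟩
      · intro e he e' he' h
        rw [Finset.mem_filter] at he he'
        exact hinj e he.1 e' he'.1 (by rw [h, he.2, he'.2])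
      · intro w hw
        rw [Finset.mem_filter] at hw
        obtain ⟨e, he, rfl, rfl⟩ := (hD _ _).1 hw.2
        exact ⟨e, by simpa using he, rfl⟩
      · intro e he
        rw [Finset.mem_filter] at he
        rw [← hc' e he.1, he.2]

/-! ### Labels as ranks -/

namespace Finset

/-- The number of elements of `A` whose key is at most the key of `e`. -/
def rankBy {α κ : Type*} [LinearOrder κ] (A : Finset α) (key : α → κ) (e : α) : ℕ :=
  #{x ∈ A | key x ≤ key e}

section rankBy

variable {α κ : Type*} [LinearOrder κ] {A : Finset α} {key : α → κ} {e e' : α}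

theorem rankBy_lt_rankBy (he' : e' ∈ A) (h : key e < key e') :
    A.rankBy key e < A.rankBy key e' := by
  apply card_lt_card
  rw [ssubset_iff_of_subset (monotone_filter_right _ fun x _ hx => le_trans hx h.le)]
  exact ⟨e', by simp [he'], by simp [h]⟩

theorem rankBy_injOn (hkey : Set.InjOn key A) : Set.InjOn (A.rankBy key) A := by
  intro e he e' he' h
  rcases lt_trichotomy (key e) (key e') with hlt | heq | hgt
  · exact absurd h (rankBy_lt_rankBy he' hlt).ne
  · exact hkey he he' heq
  · exact absurd h (rankBy_lt_rankBy he hgt).ne'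

theorem one_le_rankBy (he : e ∈ A) : 1 ≤ A.rankBy key e :=
  card_pos.2 ⟨e, by simp [he]⟩

theorem rankBy_le_card : A.rankBy key e ≤ A.card := card_filter_le _ _

theorem rankBy_eq_add_card (h : key e ≤ key e') :
    A.rankBy key e' = A.rankBy key e + #{x ∈ A | key e < key x ∧ key x ≤ key e'} := by
  classical
  unfold rankBy
  rw [← card_union_of_disjoint]
  · congr 1
    ext x
    simp only [mem_filter, mem_union]
    constructor
    · rintro ⟨h1, h2⟩
      rcases le_or_gt (key x) (key e) with h3 | h3
      · exact Or.inl ⟨h1, h3⟩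
      · exact Or.inr ⟨h1, h3, h2⟩
    · rintro (⟨h1, h2⟩ | ⟨h1, -, h2⟩)
      · exact ⟨h1, h2.trans h⟩
      · exact ⟨h1, h2⟩
  · rw [disjoint_filter]
    exact fun x _ h1 h2 => absurd h1 (not_le.2 h2.1)

theorem rankBy_eq_succ (hkey : Set.InjOn key A) (he' : e' ∈ A) (hlt : key e < key e')
    (h : ∀ x ∈ A, key e < key x → key e' ≤ key x) :
    A.rankBy key e' = A.rankBy key e + 1 := by
  rw [rankBy_eq_add_card hlt.le]
  congr 1
  rw [card_eq_one]
  refine ⟨e', ?_⟩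
  ext x
  simp only [mem_filter, mem_singleton]
  constructor
  · rintro ⟨h1, h2, h3⟩
    exact hkey h1 he' (le_antisymm h3 (h x h1 h2))
  · rintro rfl
    exact ⟨he', hlt, le_rfl⟩

end rankBy

end Finset

/-! ### The order of the sections -/

/-- The position of the `s`-th of `n` sections of the `i`-th tour in the order in which the sections
receive their labels. The sections of tours with an odd number of sections come first, level by
level from both ends; each tour with an even number of sections forms a block of its own. -/
def sectionKey (i n s : ℕ) : ℕ ×ₗ ℕ ×ₗ ℕ ×ₗ ℕ :=
  if n % 2 = 1 then
    if min s (n - 1 - s) = 0 then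
      toLex (0, toLex (0, toLex (if s ≤ n - 1 - s then 0 else 1, i)))
    else toLex (0, toLex (min s (n - 1 - s), toLex (i, if s ≤ n - 1 - s then 0 else 1)))
  else toLex (1, toLex (i, toLex (min s (n - 1 - s), if s ≤ n - 1 - s then 0 else 1)))

theorem sectionKey_inj {i n s i' n' s' : ℕ} (hn : i = i' → n = n') (hs : s < n) (hs' : s' < n')
    (h : sectionKey i n s = sectionKey i' n' s') : i = i' ∧ s = s' := by
  unfold sectionKey at h
  split_ifs at h <;> simp only [EmbeddingLike.apply_eq_iff_eq, Prod.mk.injEq] at h <;> omega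

/-- `s₀` and `s` are the two sections that meet at the start of section `s`, and their
directions differ there. -/
def IsJoint (n s₀ s : ℕ) : Prop :=
  (0 < s ∧ s < n ∧ s₀ + 1 = s) ∨ (n % 2 = 0 ∧ 2 ≤ n ∧ s = 0 ∧ s₀ + 1 = n)

theorem sectionKey_lt_iff {i n s i' n' s' : ℕ} :
    sectionKey i n s < sectionKey i' n' s' ↔
      if n % 2 = 1 then
        if n' % 2 = 1 then
          if min s (n - 1 - s) = 0 then
            0 < min s' (n' - 1 - s') ∨
              ((s ≤ n - 1 - s ∧ n' - 1 - s' < s') ∨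
                ((s ≤ n - 1 - s ↔ s' ≤ n' - 1 - s') ∧ i < i'))
          else
            min s (n - 1 - s) < min s' (n' - 1 - s') ∨
              (min s (n - 1 - s) = min s' (n' - 1 - s') ∧
                (i < i' ∨ (i = i' ∧ s ≤ n - 1 - s ∧ n' - 1 - s' < s')))
        else True
      else
        if n' % 2 = 1 then False
        else i < i' ∨ (i = i' ∧ (min s (n - 1 - s) < min s' (n' - 1 - s') ∨
          (min s (n - 1 - s) = min s' (n' - 1 - s') ∧ s ≤ n - 1 - s ∧ n' - 1 - s' < s'))) := by
  unfold sectionKey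
  split_ifs <;> simp only [Prod.Lex.toLex_lt_toLex, iff_true, iff_false, true_and] <;>
    omega

theorem sectionKey_lt_of_level_lt {i n s i' n' s' : ℕ} (hn : n % 2 = 1) (hn' : n' % 2 = 1)
    (h : min s (n - 1 - s) < min s' (n' - 1 - s')) :
    sectionKey i n s < sectionKey i' n' s' := by
  rw [sectionKey_lt_iff, if_pos hn, if_pos hn']
  split_ifs
  · exact Or.inl (by omega)
  · exact Or.inl h

theorem sectionKey_lt_of_index_lt {i n s i' n' s' : ℕ} (hn : n % 2 = 1) (hn' : n' % 2 = 1)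
    (h : min s (n - 1 - s) = min s' (n' - 1 - s')) (hi : i < i')
    (h0 : 0 < min s (n - 1 - s) ∨ (s ≤ n - 1 - s ↔ s' ≤ n' - 1 - s')) :
    sectionKey i n s < sectionKey i' n' s' := by
  rw [sectionKey_lt_iff, if_pos hn, if_pos hn']
  split_ifs with h1
  · exact Or.inr (Or.inr ⟨h0.resolve_left (by omega), hi⟩)
  · exact Or.inr ⟨h, Or.inl hi⟩

/-- A joint connects levels `k` and `k + 1`; if the values of `k` differ, levels decide. Here `k` is
`s - 1` in the first half and `n - 1 - s` in the second, of opposite parities for odd `n`. So equal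
`k` and equal parity of `s` force the same half, and the tour index decides. -/
theorem IsJoint.sectionKey_lt_of_odd {i n s₀ s i' n' s₀' s' : ℕ} (hp : n % 2 = 1)
    (hp' : n' % 2 = 1) (hn : i = i' → n = n') (h : IsJoint n s₀ s) (h' : IsJoint n' s₀' s')
    (hpar : s % 2 = s' % 2) (hne : ¬(i = i' ∧ s = s')) :
    (sectionKey i n s₀ < sectionKey i' n' s₀' ∧ sectionKey i n s < sectionKey i' n' s') ∨
    (sectionKey i n s₀ < sectionKey i' n' s' ∧ sectionKey i n s < sectionKey i' n' s₀') ∨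
    (sectionKey i' n' s₀' < sectionKey i n s₀ ∧ sectionKey i' n' s' < sectionKey i n s) ∨
    (sectionKey i' n' s' < sectionKey i n s₀ ∧ sectionKey i' n' s₀' < sectionKey i n s) := by
  obtain ⟨h1, h2, rfl⟩ : 0 < s ∧ s < n ∧ s₀ + 1 = s := by unfold IsJoint at h; omega
  obtain ⟨h1', h2', rfl⟩ : 0 < s' ∧ s' < n' ∧ s₀' + 1 = s' := by unfold IsJoint at h'; omega
  clear h h'
  have lev : ∀ m r, m % 2 = 1 → r + 1 < m →
      (2 * (r + 1) < m ∧ min r (m - 1 - r) = r ∧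
        min (r + 1) (m - 1 - (r + 1)) = r + 1) ∨
      (m < 2 * (r + 1) ∧ min r (m - 1 - r) = m - 1 - r ∧
        min (r + 1) (m - 1 - (r + 1)) = m - 1 - (r + 1)) := by omega
  rcases lev n s₀ hp h2 with ⟨hl, e0, e1⟩ | ⟨hl, e0, e1⟩ <;>
    rcases lev n' s₀' hp' h2' with ⟨hl', e0', e1'⟩ | ⟨hl', e0', e1'⟩
  · rcases lt_trichotomy s₀ s₀' with hk | hk | hk
    · exact Or.inl ⟨sectionKey_lt_of_level_lt hp hp' (by omega),
        sectionKey_lt_of_level_lt hp hp' (by omega)⟩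
    · rcases lt_or_gt_of_ne (show i ≠ i' by omega) with hi | hi
      · exact Or.inl ⟨sectionKey_lt_of_index_lt hp hp' (by omega) hi (by omega),
          sectionKey_lt_of_index_lt hp hp' (by omega) hi (by omega)⟩
      · exact Or.inr (Or.inr (Or.inl
          ⟨sectionKey_lt_of_index_lt hp' hp (by omega) hi (by omega),
            sectionKey_lt_of_index_lt hp' hp (by omega) hi (by omega)⟩))
    · exact Or.inr (Or.inr (Or.inl ⟨sectionKey_lt_of_level_lt hp' hp (by omega),
        sectionKey_lt_of_level_lt hp' hp (by omega)⟩))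
  -- In opposite halves the lower levels differ in parity and cannot tie.
  · rcases lt_or_gt_of_ne (show s₀ ≠ n' - 1 - (s₀' + 1) by omega) with hk | hk
    · exact Or.inr (Or.inl ⟨sectionKey_lt_of_level_lt hp hp' (by omega),
        sectionKey_lt_of_level_lt hp hp' (by omega)⟩)
    · exact Or.inr (Or.inr (Or.inr ⟨sectionKey_lt_of_level_lt hp' hp (by omega),
        sectionKey_lt_of_level_lt hp' hp (by omega)⟩))
  · rcases lt_or_gt_of_ne (show n - 1 - (s₀ + 1) ≠ s₀' by omega) with hk | hk
    · exact Or.inr (Or.inl ⟨sectionKey_lt_of_level_lt hp hp' (by omega),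
        sectionKey_lt_of_level_lt hp hp' (by omega)⟩)
    · exact Or.inr (Or.inr (Or.inr ⟨sectionKey_lt_of_level_lt hp' hp (by omega),
        sectionKey_lt_of_level_lt hp' hp (by omega)⟩))
  · rcases lt_trichotomy (n - 1 - (s₀ + 1)) (n' - 1 - (s₀' + 1)) with hk | hk | hk
    · exact Or.inl ⟨sectionKey_lt_of_level_lt hp hp' (by omega),
        sectionKey_lt_of_level_lt hp hp' (by omega)⟩
    · rcases lt_or_gt_of_ne (show i ≠ i' by omega) with hi | hi
      · exact Or.inl ⟨sectionKey_lt_of_index_lt hp hp' (by omega) hi (by omega),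
          sectionKey_lt_of_index_lt hp hp' (by omega) hi (by omega)⟩
      · exact Or.inr (Or.inr (Or.inl
          ⟨sectionKey_lt_of_index_lt hp' hp (by omega) hi (by omega),
            sectionKey_lt_of_index_lt hp' hp (by omega) hi (by omega)⟩))
    · exact Or.inr (Or.inr (Or.inl ⟨sectionKey_lt_of_level_lt hp' hp (by omega),
        sectionKey_lt_of_level_lt hp' hp (by omega)⟩))

/-- On a tour with an even number of sections the order is 0, n-1, 1, n-2, …. By places in it, the
joints form the chain (0,1), (0,2), (1,3), …, (n-3,n-1), (n-2,n-1), where ties occur only between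
the two joints at either end, whose `s` have opposite parities. -/
theorem IsJoint.sectionKey_lt {i n s₀ s i' n' s₀' s' : ℕ} (hn : i = i' → n = n')
    (h : IsJoint n s₀ s) (h' : IsJoint n' s₀' s') (hpar : s % 2 = s' % 2)
    (hne : ¬(i = i' ∧ s = s')) :
    (sectionKey i n s₀ < sectionKey i' n' s₀' ∧ sectionKey i n s < sectionKey i' n' s') ∨
    (sectionKey i n s₀ < sectionKey i' n' s' ∧ sectionKey i n s < sectionKey i' n' s₀') ∨
    (sectionKey i' n' s₀' < sectionKey i n s₀ ∧ sectionKey i' n' s' < sectionKey i n s) ∨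
    (sectionKey i' n' s' < sectionKey i n s₀ ∧ sectionKey i' n' s₀' < sectionKey i n s) := by
  by_cases hodd : n % 2 = 1 ∧ n' % 2 = 1
  · exact h.sectionKey_lt_of_odd hodd.1 hodd.2 hn h' hpar hne
  rcases Nat.mod_two_eq_zero_or_one n with hp | hp <;>
    rcases Nat.mod_two_eq_zero_or_one n' with hp' | hp' <;>
    simp only [sectionKey_lt_iff, hp, hp', zero_ne_one, if_true, if_false, and_self, true_or,
      or_true]
  · rcases lt_trichotomy i i' with hi | hi | hi
    · exact Or.inl ⟨Or.inl hi, Or.inl hi⟩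
    · obtain rfl := hn hi
      have hss : s ≠ s' := fun hs => hne ⟨hi, hs⟩
      simp only [hi, lt_irrefl, true_and, false_or]
      clear hn hne hi
      rcases h with ⟨h1, h2, rfl⟩ | ⟨-, h2, rfl, h3⟩ <;>
        rcases h' with ⟨h1', h2', rfl⟩ | ⟨-, h2', rfl, h3'⟩
      -- The `if` expressions give the place of a joint in the chain: odd in the first half, even in
      -- the second.
      · by_cases hl : 2 * (s₀ + 1) ≤ n <;> by_cases hl' : 2 * (s₀' + 1) ≤ n <;>
        rcases lt_or_ge (if 2 * (s₀ + 1) ≤ n then 2 * s₀ + 1 else 2 * (n - (s₀ + 1)))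
          (if 2 * (s₀' + 1) ≤ n then 2 * s₀' + 1 else 2 * (n - (s₀' + 1))) with hk | hk <;>
        simp only [hl, hl', if_true, if_false] at hk <;>
        first
        | exact Or.inl ⟨by omega, by omega⟩
        | exact Or.inr (Or.inl ⟨by omega, by omega⟩)
        | exact Or.inr (Or.inr (Or.inl ⟨by omega, by omega⟩))
        | exact Or.inr (Or.inr (Or.inr ⟨by omega, by omega⟩))
      · exact Or.inr (Or.inr (Or.inl ⟨by omega, by omega⟩))
      · exact Or.inl ⟨by omega, by omega⟩
      · exact absurd rfl hss
    · exact Or.inr (Or.inr (Or.inl ⟨Or.inl hi, Or.inl hi⟩))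
  · exact absurd ⟨hp, hp'⟩ hodd

open Finset

/-! ### Cutting a tour into sections -/

/-- The index of the section of `t`, where a new section starts at each element of `P`. -/
def sectionIndex (P : Finset ℕ) (t : ℕ) : ℕ := #{p ∈ P | p ≤ t} - 1

section sectionIndex

variable {P : Finset ℕ} {t : ℕ}

theorem sectionIndex_add_one (h0 : 0 ∈ P) (t : ℕ) : sectionIndex P t + 1 = #{p ∈ P | p ≤ t} := by
  have : 0 < #{p ∈ P | p ≤ t} := card_pos.2 ⟨0, by simp [h0]⟩
  unfold sectionIndex
  omega

theorem sectionIndex_zero : sectionIndex P 0 = 0 := by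
  have : #{p ∈ P | p ≤ 0} ≤ #{0} := card_le_card fun p hp => by simp_all
  rw [card_singleton] at this
  unfold sectionIndex
  omega

theorem sectionIndex_succ_of_notMem (h : t + 1 ∉ P) :
    sectionIndex P (t + 1) = sectionIndex P t := by
  unfold sectionIndex
  congr 2
  refine filter_congr fun p hp => ?_
  have : p ≠ t + 1 := fun h' => h (h' ▸ hp)
  omega

theorem sectionIndex_lt_of_lt (h0 : 0 ∈ P) {t' : ℕ} (ht' : t' ∈ P) (h : t < t') :
    sectionIndex P t < sectionIndex P t' := by
  have : #{p ∈ P | p ≤ t} < #{p ∈ P | p ≤ t'} := by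
    apply card_lt_card
    rw [ssubset_iff_of_subset (monotone_filter_right _ fun x _ hx => le_trans hx h.le)]
    exact ⟨t', by simp [ht'], by simp [h]⟩
  have h1 := sectionIndex_add_one h0 t
  have h2 := sectionIndex_add_one h0 t'
  omega

theorem sectionIndex_succ_of_mem (h0 : 0 ∈ P) (h : t + 1 ∈ P) :
    sectionIndex P (t + 1) = sectionIndex P t + 1 := by
  have h1 := sectionIndex_add_one h0 t
  have h2 := sectionIndex_add_one h0 (t + 1)
  have h3 : ({p ∈ P | p ≤ t + 1} : Finset ℕ) = insert (t + 1) {p ∈ P | p ≤ t} := by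
    ext p
    simp only [mem_filter, mem_insert]
    constructor
    · rintro ⟨h4, h5⟩
      rcases Nat.lt_or_eq_of_le h5 with h6 | h6
      · exact Or.inr ⟨h4, by omega⟩
      · exact Or.inl h6
    · rintro (rfl | ⟨h4, h5⟩)
      · exact ⟨h, le_rfl⟩
      · exact ⟨h4, by omega⟩
  rw [h3, card_insert_of_notMem (by simp)] at h2
  omega

theorem sectionIndex_lt_card (h0 : 0 ∈ P) (t : ℕ) : sectionIndex P t < #P := by
  have h1 := sectionIndex_add_one h0 t
  have h2 : #{p ∈ P | p ≤ t} ≤ #P := card_filter_le _ _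
  omega

theorem sectionIndex_of_forall_le (h : ∀ p ∈ P, p ≤ t) : sectionIndex P t = #P - 1 := by
  unfold sectionIndex
  rw [filter_true_of_mem h]

end sectionIndex

/-! ### Sums over edges as sums over visits -/

namespace SimpleGraph.EulerTours

variable {V ι : Type*} {G : SimpleGraph V} (T : EulerTours G ι)

/-- The cyclic predecessor of `t` on the `i`-th tour. -/
def prev (i : ι) (t : ℕ) : ℕ := if t = 0 then T.len i - 1 else t - 1

/-- The positions at which the `i`-th tour visits `u`. -/
def visits [DecidableEq V] (i : ι) (u : V) : Finset ℕ := {t ∈ range (T.len i) | T.vert i t = u}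

/-- The edges of the tours, as pairs of a tour and a position. -/
def edges [Fintype ι] : Finset (Σ _ : ι, ℕ) := univ.sigma fun i => range (T.len i)

theorem mem_edges [Fintype ι] {i : ι} {t : ℕ} : (⟨i, t⟩ : Σ _ : ι, ℕ) ∈ T.edges ↔ t < T.len i := by
  simp [edges]

theorem prev_lt_len (i : ι) {t : ℕ} (ht : t < T.len i) : T.prev i t < T.len i := by
  unfold prev
  split_ifs <;> omega

theorem two_le_len (i : ι) : 2 ≤ T.len i := by
  by_contra h
  have h1 : T.len i = 1 := by have := T.len_pos i; omega
  have h2 := (T.adj i 0 (T.len_pos i)).ne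
  rw [zero_add, ← h1, T.closed] at h2
  exact h2 rfl

theorem sum_edges_eq_sum_visits [DecidableEq V] (i : ι) (f g : ℕ → ℤ) (u : V) :
    ∑ t ∈ range (T.len i), ((if T.vert i (t + 1) = u then g t else 0) +
      if T.vert i t = u then f t else 0) = ∑ t ∈ T.visits i u, (g (T.prev i t) + f t) := by
  unfold visits
  rw [sum_add_distrib, sum_add_distrib, ← sum_filter, ← sum_filter]
  congr 1
  rw [sum_filter, sum_filter]
  have hclosed := T.closed i
  have hlen := T.len_pos i
  unfold prev
  generalize T.len i = m at *
  obtain ⟨k, rfl⟩ : ∃ k, m = k + 1 := ⟨m - 1, by omega⟩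
  rw [sum_range_succ, sum_range_succ']
  simp [hclosed]

theorem sum_sum_visits [Fintype ι] [DecidableEq V] (f : ι → ℕ → ℤ) {i : ι} {t : ℕ} {u : V}
    (hu : T.vert i t = u) : ∑ j, ∑ t ∈ T.visits j u, f j t = ∑ t ∈ T.visits i u, f i t := by
  refine sum_eq_single i (fun j _ hj => ?_) (by simp)
  refine sum_eq_zero fun t' ht' => absurd ?_ hj
  exact T.eq_of_vert_eq j i t' t (by rw [hu]; exact (mem_filter.1 ht').2)

/-- Each visit uses two edges: this is `sum_edges_eq_sum_visits` with all weights 1. -/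
theorem two_mul_card_visits [Fintype V] [DecidableRel G.Adj] [Fintype ι] [DecidableEq V] {i : ι}
    {t : ℕ} {u : V} (hu : T.vert i t = u) : 2 * #(T.visits i u) = G.degree u := by
  have h1 : G.degree u = #{e ∈ T.edges | u ∈ s(T.vert e.1 e.2, T.vert e.1 (e.2 + 1))} := by
    rw [← card_incidenceFinset_eq_degree]
    symm
    apply card_bij (fun e _ => s(T.vert e.1 e.2, T.vert e.1 (e.2 + 1)))
    · rintro ⟨j, t⟩ he
      rw [mem_filter, mem_edges] at he
      rw [mem_incidenceFinset]
      exact ⟨T.adj j t he.1, he.2⟩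
    · rintro ⟨j, t⟩ he ⟨j', t'⟩ he' h
      rw [mem_filter, mem_edges] at he he'
      obtain ⟨rfl, rfl⟩ := T.edge_inj j j' t t' he.1 he'.1 h
      rfl
    · intro e he
      rw [mem_incidenceFinset] at he
      induction e with
      | h x y =>
        obtain ⟨j, t, ht, h⟩ := T.edge_surj x y he.1
        refine ⟨⟨j, t⟩, ?_, h⟩
        rw [mem_filter, mem_edges]
        exact ⟨ht, h ▸ he.2⟩
  have h2 : ∀ j, ∑ t ∈ T.visits j u, (2 : ℤ) = ∑ t ∈ range (T.len j),
      if u ∈ s(T.vert j t, T.vert j (t + 1)) then (1 : ℤ) else 0 := by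
    intro j
    rw [show (2 : ℤ) = 1 + 1 from rfl,
      ← T.sum_edges_eq_sum_visits j (fun _ => 1) (fun _ => 1) u]
    refine sum_congr rfl fun t ht => ?_
    have h3 := (T.adj j t (mem_range.1 ht)).ne
    simp only [Sym2.mem_iff, eq_comm (a := u)]
    by_cases h4 : T.vert j t = u <;> by_cases h5 : T.vert j (t + 1) = u <;> simp [h4, h5]
    exact absurd (h4.trans h5.symm) h3
  have h3 := T.sum_sum_visits (fun _ _ => 2) hu
  rw [sum_congr rfl fun j _ => h2 j] at h3
  rw [card_filter, edges, sum_sigma] at h1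
  simp only [sum_const, nsmul_eq_mul] at h3
  zify
  rw [h1, mul_comm, ← h3]
  push_cast
  rfl

end SimpleGraph.EulerTours

/-- Level 0 lists all first sections, then all last sections by tour index, so nothing else
separates two last sections. -/
theorem sectionKey_between {i n i' n' j k s : ℕ} (hn : n % 2 = 1) (hn' : n' % 2 = 1) (h2 : 2 ≤ n)
    (hs : s < k) (h : sectionKey i n (n - 1) < sectionKey j k s)
    (h' : sectionKey j k s < sectionKey i' n' (n' - 1)) :
    k % 2 = 1 ∧ s = k - 1 ∧ i < j ∧ j < i' := by
  rw [sectionKey_lt_iff] at h'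
  have hk : k % 2 = 1 := by
    by_contra hk
    rw [if_neg hk, if_pos hn'] at h'
    exact h'
  rw [sectionKey_lt_iff, if_pos hn, if_pos hk] at h
  split_ifs at h h' <;> omega

/-- On a tour with an odd number of sections, a joint has a section of level at least 1, while last
sections have level 0. Tours with an even number come later altogether. -/
theorem IsJoint.sectionKey_last_lt {i n s₀ s i' n' : ℕ} (h : IsJoint n s₀ s) (hs : s % 2 = 1)
    (hn' : n' % 2 = 1) :
    sectionKey i' n' (n' - 1) < sectionKey i n s₀ ∨ sectionKey i' n' (n' - 1) < sectionKey i n s := by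
  unfold IsJoint at h
  by_cases hn : n % 2 = 1
  · by_cases hl : 2 * s < n
    · exact Or.inr (sectionKey_lt_of_level_lt hn' hn (by omega))
    · exact Or.inl (sectionKey_lt_of_level_lt hn' hn (by omega))
  · left
    rw [sectionKey_lt_iff, if_pos hn', if_neg hn]
    trivial

/-! ### Marked visits, labels and contributions -/

namespace SimpleGraph.EulerTours

variable {V ι : Type*} {G : SimpleGraph V}

/-- A choice of one visit of the tours to each vertex. On each tour the first and the last position
are chosen, and the position after the first is not. -/
structure Marking (T : EulerTours G ι) where
  marks : ι → Finset ℕ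
  lt_len : ∀ i, ∀ t ∈ marks i, t < T.len i
  zero_mem : ∀ i, 0 ∈ marks i
  last_mem : ∀ i, T.len i - 1 ∈ marks i
  one_notMem : ∀ i, 1 ∉ marks i
  tour : V → ι
  pos : V → ℕ
  pos_mem : ∀ u, pos u ∈ marks (tour u)
  vert_pos : ∀ u, T.vert (tour u) (pos u) = u
  pos_vert : ∀ i, ∀ t ∈ marks i, pos (T.vert i t) = t

/-- The demands are compatible: the first and last vertices are adjacent, hence distinct, and the
last position is not 1, since a tour of length 2 would repeat an edge. Any other vertex has two
visits, one of them away from position 1. -/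
theorem exists_visit [Fintype V] [DecidableRel G.Adj] [Fintype ι] (T : EulerTours G ι)
    (hG : ∀ v, 4 ≤ G.degree v) (u : V) :
    ∃ i t, t < T.len i ∧ T.vert i t = u ∧ t ≠ 1 ∧ (u = T.vert i 0 → t = 0) ∧
      (u = T.vert i (T.len i - 1) → t = T.len i - 1) := by
  classical
  obtain ⟨y, hy⟩ := (G.degree_pos_iff_exists_adj u).1 (by have := hG u; omega)
  obtain ⟨i, r, hr, hu⟩ : ∃ i r, r < T.len i ∧ T.vert i r = u := by
    obtain ⟨i, r, hr, h⟩ := T.edge_surj u y hy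
    rcases Sym2.eq_iff.1 h with h | h
    · exact ⟨i, r, hr, h.1⟩
    · by_cases hl : r + 1 = T.len i
      · exact ⟨i, 0, T.len_pos i, by rw [← T.closed, ← hl, h.2]⟩
      · exact ⟨i, r + 1, by omega, h.2⟩
  have hlen := T.two_le_len i
  have hlast : G.Adj (T.vert i (T.len i - 1)) (T.vert i 0) := by
    have := T.adj i (T.len i - 1) (by omega)
    rwa [show T.len i - 1 + 1 = T.len i by omega, T.closed] at this
  have hlen3 : T.len i ≠ 2 := by
    intro h2
    have := T.edge_inj i i 0 1 (by omega) (by omega) (by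
      rw [show 1 + 1 = T.len i from h2.symm, T.closed, Sym2.eq_swap])
    omega
  refine ⟨i, ?_⟩
  by_cases h0 : u = T.vert i 0
  · refine ⟨0, by omega, h0.symm, by omega, fun _ => rfl, fun h => ?_⟩
    exact absurd (h.symm.trans h0) hlast.ne
  by_cases h1 : u = T.vert i (T.len i - 1)
  · exact ⟨T.len i - 1, by omega, h1.symm, by omega, fun h => absurd h h0, fun _ => rfl⟩
  obtain ⟨t, ht, ht1⟩ : ∃ t ∈ T.visits i u, t ≠ 1 := by
    apply exists_mem_ne
    have := T.two_mul_card_visits hu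
    have := hG u
    omega
  rw [visits, mem_filter, mem_range] at ht
  exact ⟨t, ht.1, ht.2, ht1, fun h => absurd h h0, fun h => absurd h h1⟩

theorem exists_marking [Fintype V] [DecidableRel G.Adj] [Fintype ι] (T : EulerTours G ι)
    (hG : ∀ v, 4 ≤ G.degree v) : Nonempty T.Marking := by
  classical
  choose tour pos hlt hvert h1 h0 hlast using T.exists_visit hG
  have htour : ∀ i t, tour (T.vert i t) = i := fun i t => T.eq_of_vert_eq _ _ _ _ (hvert _)
  refine ⟨⟨fun i => ({u | tour u = i} : Finset V).image pos, ?_, ?_, ?_, ?_, tour, pos, ?_, hvert,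
    ?_⟩⟩
  · intro i t ht
    obtain ⟨u, hu, rfl⟩ := mem_image.1 ht
    obtain rfl := (mem_filter.1 hu).2
    exact hlt u
  · intro i
    refine mem_image.2 ⟨T.vert i 0, by simp [htour], h0 _ ?_⟩
    rw [htour]
  · intro i
    refine mem_image.2 ⟨T.vert i (T.len i - 1), by simp [htour], ?_⟩
    rw [hlast _ (by rw [htour]), htour]
  · intro i h
    obtain ⟨u, -, hu⟩ := mem_image.1 h
    exact h1 u hu
  · exact fun u => mem_image.2 ⟨u, by simp, rfl⟩
  · intro i t ht
    obtain ⟨u, hu, rfl⟩ := mem_image.1 ht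
    obtain rfl := (mem_filter.1 hu).2
    rw [hvert]

namespace Marking

variable {T : EulerTours G ι} (M : T.Marking) (idx : ι → ℕ)

/-- The section of the `i`-th tour that contains the edge at position `t`. -/
def sec (i : ι) (t : ℕ) : ℕ := sectionIndex (M.marks i) t

/-- The position of the section that contains an edge in the order of the sections. -/
def secKey (i : ι) (t : ℕ) : ℕ ×ₗ ℕ ×ₗ ℕ ×ₗ ℕ := sectionKey (idx i) #(M.marks i) (M.sec i t)

/-- The edges are labelled in increasing order of this key: section by section, and within a section
in the direction in which the section is oriented. -/
def edgeKey (e : Σ _ : ι, ℕ) : (ℕ ×ₗ ℕ ×ₗ ℕ ×ₗ ℕ) ×ₗ ℤ :=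
  toLex (M.secKey idx e.1 e.2, if M.sec e.1 e.2 % 2 = 0 then (e.2 : ℤ) else -e.2)

/-- The label of the edge at position `t` of the `i`-th tour. -/
def label [Fintype ι] (i : ι) (t : ℕ) : ℕ := T.edges.rankBy (M.edgeKey idx) ⟨i, t⟩

/-- The sign with which an edge contributes to its second vertex on the tour. -/
def sign (i : ι) (t : ℕ) : ℤ := if M.sec i t % 2 = 0 then 1 else -1

/-- The contribution of the visit at position `t` of the `i`-th tour to the vertex-sum. -/
def visitSum [Fintype ι] (i : ι) (t : ℕ) : ℤ :=
  M.sign i (T.prev i t) * M.label idx i (T.prev i t) - M.sign i t * M.label idx i t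

theorem sec_zero (i : ι) : M.sec i 0 = 0 := sectionIndex_zero

theorem sec_last (i : ι) : M.sec i (T.len i - 1) = #(M.marks i) - 1 :=
  sectionIndex_of_forall_le fun p hp => by have := M.lt_len i p hp; omega

theorem sec_lt (i : ι) (t : ℕ) : M.sec i t < #(M.marks i) :=
  sectionIndex_lt_card (M.zero_mem i) t

/-- The last position is itself marked, so the last section is a single edge. -/
theorem eq_last_of_sec_eq {i : ι} {t : ℕ} (ht : t < T.len i) (h : M.sec i t = #(M.marks i) - 1) :
    t = T.len i - 1 := by
  by_contra hne
  have := sectionIndex_lt_of_lt (M.zero_mem i) (M.last_mem i) (show t < T.len i - 1 by omega)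
  rw [← sec, ← sec, h, sec_last] at this
  exact lt_irrefl _ this

theorem sec_injOn (i : ι) : Set.InjOn (M.sec i) (M.marks i) := by
  intro t ht t' ht' h
  rcases lt_trichotomy t t' with hlt | heq | hgt
  · exact absurd h (sectionIndex_lt_of_lt (M.zero_mem i) ht' hlt).ne
  · exact heq
  · exact absurd h (sectionIndex_lt_of_lt (M.zero_mem i) ht hgt).ne'

theorem two_le_card_marks (i : ι) : 2 ≤ #(M.marks i) := by
  have := T.two_le_len i
  refine one_lt_card.2 ⟨0, M.zero_mem i, _, M.last_mem i, by omega⟩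

theorem isJoint_sec {i : ι} {t : ℕ} (ht : t ∈ M.marks i) (h : t ≠ 0 ∨ #(M.marks i) % 2 = 0) :
    IsJoint #(M.marks i) (M.sec i (T.prev i t)) (M.sec i t) := by
  have h2 := M.two_le_card_marks i
  rcases Nat.eq_zero_or_pos t with rfl | hpos
  · refine Or.inr ⟨h.resolve_left (by simp), h2, M.sec_zero i, ?_⟩
    rw [prev, if_pos rfl, sec_last]
    omega
  · obtain ⟨r, rfl⟩ : ∃ r, t = r + 1 := ⟨t - 1, by omega⟩
    have hprev : T.prev i (r + 1) = r := by simp [prev]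
    have hsec : M.sec i (r + 1) = M.sec i r + 1 := sectionIndex_succ_of_mem (M.zero_mem i) ht
    exact Or.inl ⟨by omega, M.sec_lt i _, by rw [hprev, hsec]⟩

variable {idx}

theorem secKey_inj (hidx : Function.Injective idx) {i j : ι} {t t' : ℕ}
    (h : M.secKey idx i t = M.secKey idx j t') : i = j ∧ M.sec i t = M.sec j t' := by
  have := sectionKey_inj (fun h => by rw [hidx h]) (M.sec_lt i t) (M.sec_lt j t') h
  exact ⟨hidx this.1, this.2⟩

theorem edgeKey_injective (hidx : Function.Injective idx) :
    Function.Injective (M.edgeKey idx) := by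
  rintro ⟨i, t⟩ ⟨j, t'⟩ h
  simp only [edgeKey, EmbeddingLike.apply_eq_iff_eq, Prod.mk.injEq] at h
  obtain ⟨h1, h2⟩ := h
  obtain ⟨rfl, h3⟩ := M.secKey_inj hidx h1
  rw [h3] at h2
  have : t = t' := by split_ifs at h2 <;> omega
  rw [this]

section label

variable [Fintype ι]

theorem label_pos {i : ι} {t : ℕ} (ht : t < T.len i) : 1 ≤ M.label idx i t :=
  one_le_rankBy (T.mem_edges.2 ht)

theorem label_lt {i j : ι} {t t' : ℕ} (ht' : t' < T.len j)
    (h : M.secKey idx i t < M.secKey idx j t') : M.label idx i t < M.label idx j t' :=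
  rankBy_lt_rankBy (T.mem_edges.2 ht') (Prod.Lex.toLex_lt_toLex.2 (Or.inl h))

theorem label_succ_of_even (hidx : Function.Injective idx) {i : ι} {t : ℕ} (ht : t + 1 < T.len i)
    (hm : t + 1 ∉ M.marks i) (hs : M.sec i t % 2 = 0) :
    M.label idx i (t + 1) = M.label idx i t + 1 := by
  have hsec : M.sec i (t + 1) = M.sec i t := sectionIndex_succ_of_notMem hm
  have hkey : M.secKey idx i (t + 1) = M.secKey idx i t := by rw [secKey, secKey, hsec]
  apply rankBy_eq_succ (M.edgeKey_injective hidx).injOn (T.mem_edges.2 ht)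
  · simp [edgeKey, Prod.Lex.toLex_lt_toLex, hsec, hkey, hs]
  · rintro ⟨j, r⟩ - h
    simp only [edgeKey, Prod.Lex.toLex_lt_toLex, Prod.Lex.toLex_le_toLex, hsec, hkey, hs,
      if_true] at h ⊢
    rcases h with h | ⟨h1, h2⟩
    · exact Or.inl h
    · obtain ⟨rfl, h3⟩ := M.secKey_inj hidx h1
      rw [← h3, if_pos hs] at h2
      rw [← h3, if_pos hs]
      exact Or.inr ⟨h1, by omega⟩

theorem label_succ_of_odd (hidx : Function.Injective idx) {i : ι} {t : ℕ} (ht : t + 1 < T.len i)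
    (hm : t + 1 ∉ M.marks i) (hs : M.sec i t % 2 = 1) :
    M.label idx i t = M.label idx i (t + 1) + 1 := by
  have hsec : M.sec i (t + 1) = M.sec i t := sectionIndex_succ_of_notMem hm
  have hkey : M.secKey idx i (t + 1) = M.secKey idx i t := by rw [secKey, secKey, hsec]
  have hs' : ¬ M.sec i t % 2 = 0 := by omega
  apply rankBy_eq_succ (M.edgeKey_injective hidx).injOn (T.mem_edges.2 (by omega))
  · simp [edgeKey, Prod.Lex.toLex_lt_toLex, hsec, hkey, hs]
  · rintro ⟨j, r⟩ - h
    simp only [edgeKey, Prod.Lex.toLex_lt_toLex, Prod.Lex.toLex_le_toLex, hsec, hkey, hs',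
      if_false] at h ⊢
    rcases h with h | ⟨h1, h2⟩
    · exact Or.inl h
    · obtain ⟨rfl, h3⟩ := M.secKey_inj hidx h1
      rw [← h3, if_neg hs'] at h2
      rw [← h3, if_neg hs']
      exact Or.inr ⟨h1, by push_cast at h2; omega⟩

/-- Inside a section the leaving edge has the label following that of the entering edge, in either
direction. -/
theorem visitSum_of_notMem (hidx : Function.Injective idx) {i : ι} {t : ℕ} (ht : t < T.len i)
    (hm : t ∉ M.marks i) : M.visitSum idx i t = -1 := by
  obtain ⟨r, rfl⟩ : ∃ r, t = r + 1 :=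
    Nat.exists_eq_succ_of_ne_zero fun h => hm (h ▸ M.zero_mem i)
  have hsec : M.sec i (r + 1) = M.sec i r := sectionIndex_succ_of_notMem hm
  have hprev : T.prev i (r + 1) = r := by simp [prev]
  rw [visitSum, hprev, sign, sign, hsec]
  split_ifs with h
  · rw [M.label_succ_of_even hidx ht hm h]; push_cast; ring
  · rw [M.label_succ_of_odd hidx ht hm (by omega)]; push_cast; ring

theorem visitSum_of_isJoint {i : ι} {t : ℕ}
    (h : IsJoint #(M.marks i) (M.sec i (T.prev i t)) (M.sec i t)) :
    M.visitSum idx i t = -M.sign i t * (M.label idx i (T.prev i t) + M.label idx i t) := by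
  have : M.sign i (T.prev i t) = -M.sign i t := by
    unfold IsJoint at h
    unfold sign
    split_ifs <;> first | rfl | omega
  rw [visitSum, this]
  ring

/-- The first and last sections both have even index and run forward, so one edge enters and one
leaves. -/
theorem visitSum_zero_of_odd {i : ι} (h : #(M.marks i) % 2 = 1) :
    M.visitSum idx i 0 = M.label idx i (T.len i - 1) - M.label idx i 0 := by
  have hprev : T.prev i 0 = T.len i - 1 := by simp [prev]
  rw [visitSum, hprev, sign, sign, sec_last, sec_zero, if_pos (by omega), if_pos rfl]
  ring

theorem label_zero_lt_label_last {i : ι} (h : #(M.marks i) % 2 = 1) :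
    M.label idx i 0 < M.label idx i (T.len i - 1) := by
  have h2 := M.two_le_card_marks i
  have h3 := T.two_le_len i
  apply M.label_lt (by omega)
  rw [secKey, secKey, sec_last, sec_zero, sectionKey_lt_iff, if_pos h, if_pos h]
  split_ifs <;> omega

theorem visitSum_zero_lt_of_lt (hidx : Function.Injective idx) {i i' : ι}
    (h : #(M.marks i) % 2 = 1) (h' : #(M.marks i') % 2 = 1) (hlt : idx i < idx i') :
    M.visitSum idx i' 0 < M.visitSum idx i 0 := by
  classical
  have h2 := M.two_le_card_marks i
  have h2' := M.two_le_card_marks i'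
  have hfirst : ∀ j j' : ι, #(M.marks j) % 2 = 1 → #(M.marks j') % 2 = 1 → idx j < idx j' →
      sectionKey (idx j) #(M.marks j) 0 < sectionKey (idx j') #(M.marks j') 0 :=
    fun j j' hj hj' hjj' => sectionKey_lt_of_index_lt hj hj' (by simp) hjj' (by simp)
  have hlast : sectionKey (idx i) #(M.marks i) (#(M.marks i) - 1) <
      sectionKey (idx i') #(M.marks i') (#(M.marks i') - 1) :=
    sectionKey_lt_of_index_lt h h' (by omega) hlt (by omega)
  have hle0 : M.edgeKey idx ⟨i, 0⟩ < M.edgeKey idx ⟨i', 0⟩ := by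
    refine Prod.Lex.toLex_lt_toLex.2 (Or.inl ?_)
    simpa only [secKey, sec_zero] using hfirst i i' h h' hlt
  have hle1 : M.edgeKey idx ⟨i, T.len i - 1⟩ < M.edgeKey idx ⟨i', T.len i' - 1⟩ := by
    refine Prod.Lex.toLex_lt_toLex.2 (Or.inl ?_)
    simpa only [secKey, sec_last] using hlast
  -- From tour `i` to tour `i'` the last label grows by less than the first label.
  have key : #{x ∈ T.edges | M.edgeKey idx ⟨i, T.len i - 1⟩ < M.edgeKey idx x ∧
        M.edgeKey idx x ≤ M.edgeKey idx ⟨i', T.len i' - 1⟩} <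
      #{x ∈ T.edges | M.edgeKey idx ⟨i, 0⟩ < M.edgeKey idx x ∧
        M.edgeKey idx x ≤ M.edgeKey idx ⟨i', 0⟩} := by
    have hchar : ∀ x ∈ ({x ∈ T.edges | M.edgeKey idx ⟨i, T.len i - 1⟩ < M.edgeKey idx x ∧
        M.edgeKey idx x ≤ M.edgeKey idx ⟨i', T.len i' - 1⟩} : Finset (Σ _ : ι, ℕ)),
        x.2 = T.len x.1 - 1 ∧ #(M.marks x.1) % 2 = 1 ∧ idx i < idx x.1 ∧ idx x.1 ≤ idx i' := by
      rintro ⟨j, t⟩ hx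
      rw [mem_filter, mem_edges] at hx
      obtain ⟨ht, hx1, hx2⟩ := hx
      have hne : (⟨i, T.len i - 1⟩ : Σ _ : ι, ℕ) ≠ ⟨j, t⟩ := by
        intro hh
        rw [hh] at hx1
        exact lt_irrefl _ hx1
      have hx1' : M.secKey idx i (T.len i - 1) < M.secKey idx j t := by
        rcases Prod.Lex.toLex_lt_toLex.1 hx1 with hx3 | ⟨hx3, -⟩
        · exact hx3
        · obtain ⟨rfl, hx4⟩ := M.secKey_inj hidx hx3
          rw [sec_last] at hx4
          exact absurd (by rw [M.eq_last_of_sec_eq ht hx4.symm]) hne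
      rcases Prod.Lex.toLex_le_toLex.1 hx2 with hx3 | ⟨hx3, -⟩
      · simp only [secKey, sec_last] at hx1' hx3
        obtain ⟨h4, h5, h6, h7⟩ := sectionKey_between h h' h2 (M.sec_lt j t) hx1' hx3
        exact ⟨M.eq_last_of_sec_eq ht h5, h4, h6, h7.le⟩
      · obtain ⟨rfl, hx4⟩ := M.secKey_inj hidx hx3
        rw [sec_last] at hx4
        exact ⟨M.eq_last_of_sec_eq ht hx4, h', hlt, le_rfl⟩
    -- Send each last edge counted to the first edge of its tour. The image misses position 1 of
    -- tour `i`, which is unmarked and so still in the first section.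
    rw [← card_image_of_injOn (f := fun x : Σ _ : ι, ℕ => (⟨x.1, 0⟩ : Σ _ : ι, ℕ))]
    · apply card_lt_card
      rw [ssubset_iff_of_subset]
      · have hone : M.sec i 1 = 0 := by
          have := sectionIndex_succ_of_notMem (t := 0) (M.one_notMem i)
          rwa [sectionIndex_zero] at this
        refine ⟨⟨i, 1⟩, ?_, by simp⟩
        rw [mem_filter, mem_edges]
        refine ⟨T.two_le_len i, ?_, ?_⟩
        · simp [edgeKey, Prod.Lex.toLex_lt_toLex, secKey, hone, sec_zero]
        · refine Prod.Lex.toLex_le_toLex.2 (Or.inl ?_)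
          simpa only [secKey, sec_zero, hone] using hfirst i i' h h' hlt
      · intro y hy
        obtain ⟨⟨j, t⟩, hx, rfl⟩ := mem_image.1 hy
        obtain ⟨-, h4, h5, h6⟩ := hchar _ hx
        rw [mem_filter, mem_edges]
        refine ⟨T.len_pos j, ?_, ?_⟩
        · refine Prod.Lex.toLex_lt_toLex.2 (Or.inl ?_)
          simpa only [secKey, sec_zero] using hfirst i j h h4 h5
        · rcases h6.lt_or_eq with h7 | h7
          · refine Prod.Lex.toLex_le_toLex.2 (Or.inl ?_)
            simpa only [secKey, sec_zero] using hfirst j i' h4 h' h7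
          · obtain rfl : j = i' := hidx h7
            exact le_rfl
    · rintro ⟨j, t⟩ hx ⟨j', t'⟩ hx' hj
      have e1 := (hchar _ hx).1
      have e2 := (hchar _ hx').1
      simp only [Sigma.mk.injEq, heq_eq_eq, and_true] at hj e1 e2
      subst hj
      rw [e1, e2]
  rw [M.visitSum_zero_of_odd h, M.visitSum_zero_of_odd h']
  have e0 : M.label idx i' 0 = M.label idx i 0 + _ := rankBy_eq_add_card hle0.le
  have e1 : M.label idx i' (T.len i' - 1) = M.label idx i (T.len i - 1) + _ :=
    rankBy_eq_add_card hle1.le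
  omega

end label

end Marking

end SimpleGraph.EulerTours

/-! ### Distinctness of the vertex-sums -/

namespace SimpleGraph.EulerTours.Marking

variable {V ι : Type*} {G : SimpleGraph V} {T : EulerTours G ι} (M : T.Marking) {idx : ι → ℕ}
  [Fintype ι]

theorem visitSum_ne_of_isJoint {i i' : ι} {t t' : ℕ} (hidx : Function.Injective idx)
    (ht : t < T.len i) (ht' : t' < T.len i')
    (h : IsJoint #(M.marks i) (M.sec i (T.prev i t)) (M.sec i t))
    (h' : IsJoint #(M.marks i') (M.sec i' (T.prev i' t')) (M.sec i' t'))
    (hne : ¬(i = i' ∧ M.sec i t = M.sec i' t')) :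
    M.visitSum idx i t ≠ M.visitSum idx i' t' := by
  have hp := M.label_pos (idx := idx) ht
  have hp' := M.label_pos (idx := idx) ht'
  have hpr := T.prev_lt_len i ht
  have hpr' := T.prev_lt_len i' ht'
  rw [M.visitSum_of_isJoint h, M.visitSum_of_isJoint h']
  by_cases hpar : M.sec i t % 2 = M.sec i' t' % 2
  · have hsum : M.label idx i (T.prev i t) + M.label idx i t ≠
        M.label idx i' (T.prev i' t') + M.label idx i' t' := by
      rcases h.sectionKey_lt (i := idx i) (i' := idx i') (fun hi => by rw [hidx hi]) h' hpar
        (fun hi => hne ⟨hidx hi.1, hi.2⟩) with ⟨h1, h2⟩ | ⟨h1, h2⟩ | ⟨h1, h2⟩ | ⟨h1, h2⟩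
      · have := M.label_lt (idx := idx) hpr' h1
        have := M.label_lt (idx := idx) ht' h2
        omega
      · have := M.label_lt (idx := idx) ht' h1
        have := M.label_lt (idx := idx) hpr' h2
        omega
      · have := M.label_lt (idx := idx) hpr h1
        have := M.label_lt (idx := idx) ht h2
        omega
      · have := M.label_lt (idx := idx) hpr h1
        have := M.label_lt (idx := idx) ht h2
        omega
    unfold sign
    rw [hpar]
    split_ifs <;> omega
  -- Opposite parities give sums of opposite sign.
  · unfold sign
    split_ifs <;> omega

/-- If both edges leave, the joint is negative and the difference positive. If both enter, one label
at the joint already exceeds the last label of tour `i'`. -/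
theorem visitSum_ne_visitSum_zero {i i' : ι} {t : ℕ} (ht : t < T.len i)
    (h : IsJoint #(M.marks i) (M.sec i (T.prev i t)) (M.sec i t)) (h' : #(M.marks i') % 2 = 1) :
    M.visitSum idx i t ≠ M.visitSum idx i' 0 := by
  have hp := M.label_pos (idx := idx) ht
  have hpr := T.prev_lt_len i ht
  have hp1 := M.label_pos (idx := idx) hpr
  have hp0 := M.label_pos (idx := idx) (T.len_pos i')
  have hjump := M.label_zero_lt_label_last (idx := idx) h'
  rw [M.visitSum_of_isJoint h, M.visitSum_zero_of_odd h']
  unfold sign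
  split_ifs with hs
  · omega
  · have hlt : M.label idx i' (T.len i' - 1) < M.label idx i (T.prev i t) ∨
        M.label idx i' (T.len i' - 1) < M.label idx i t := by
      rcases h.sectionKey_last_lt (i := idx i) (i' := idx i') (by omega) h' with h1 | h1
      · exact Or.inl (M.label_lt hpr (by rwa [secKey, sec_last]))
      · exact Or.inr (M.label_lt ht (by rwa [secKey, sec_last]))
    omega

theorem visitSum_pos_injective (hidx : Function.Injective idx) :
    Function.Injective fun u => M.visitSum idx (M.tour u) (M.pos u) := by
  intro u v huv
  by_contra hne
  have hmu := M.pos_mem u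
  have hmv := M.pos_mem v
  have hu := M.vert_pos u
  have hv := M.vert_pos v
  simp only at huv
  generalize M.tour u = i at *
  generalize M.pos u = t at *
  generalize M.tour v = i' at *
  generalize M.pos v = t' at *
  have hne' : ¬(i = i' ∧ t = t') := fun h => hne (by rw [← hu, ← hv, h.1, h.2])
  have ht := M.lt_len _ _ hmu
  have ht' := M.lt_len _ _ hmv
  by_cases h : t ≠ 0 ∨ #(M.marks i) % 2 = 0 <;> by_cases h' : t' ≠ 0 ∨ #(M.marks i') % 2 = 0
  · refine M.visitSum_ne_of_isJoint hidx ht ht' (M.isJoint_sec hmu h) (M.isJoint_sec hmv h') ?_ huv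
    rintro ⟨rfl, hs⟩
    exact hne' ⟨rfl, M.sec_injOn i hmu hmv hs⟩
  · obtain rfl : t' = 0 := by omega
    exact M.visitSum_ne_visitSum_zero ht (M.isJoint_sec hmu h) (by omega) huv
  · obtain rfl : t = 0 := by omega
    exact M.visitSum_ne_visitSum_zero ht' (M.isJoint_sec hmv h') (by omega) huv.symm
  · obtain rfl : t = 0 := by omega
    obtain rfl : t' = 0 := by omega
    rcases lt_trichotomy (idx i) (idx i') with hi | hi | hi
    · exact (M.visitSum_zero_lt_of_lt hidx (by omega) (by omega) hi).ne' huv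
    · exact hne' ⟨hidx hi, rfl⟩
    · exact (M.visitSum_zero_lt_of_lt hidx (by omega) (by omega) hi).ne huv

theorem sum_visits_visitSum [DecidableEq V] (hidx : Function.Injective idx) (u : V) :
    ∑ t ∈ T.visits (M.tour u) u, M.visitSum idx (M.tour u) t =
      M.visitSum idx (M.tour u) (M.pos u) - (#(T.visits (M.tour u) u) - 1) := by
  have hpos : M.pos u ∈ T.visits (M.tour u) u :=
    mem_filter.2 ⟨mem_range.2 (M.lt_len _ _ (M.pos_mem u)), M.vert_pos u⟩
  rw [← add_sum_erase _ _ hpos, sum_congr rfl (g := fun _ => (-1 : ℤ))]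
  · have : 0 < #(T.visits (M.tour u) u) := card_pos.2 ⟨_, hpos⟩
    rw [sum_const, card_erase_of_mem hpos]
    simp only [nsmul_eq_mul]
    push_cast [Nat.cast_sub this]
    ring
  · intro t ht
    rw [mem_erase, visits, mem_filter, mem_range] at ht
    -- By `pos_vert`, the only marked visit to `u` is `M.pos u`.
    refine M.visitSum_of_notMem hidx ht.2.1 fun hm => ht.1 ?_
    rw [← M.pos_vert _ t hm, ht.2.2]

theorem hasAntimagicOrientation [Fintype V] [DecidableRel G.Adj] (M : T.Marking) {d : ℕ}
    (hG : G.IsRegularOfDegree (2 * d)) : G.HasAntimagicOrientation := by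
  classical
  obtain ⟨idx, hidx⟩ : ∃ idx : ι → ℕ, Function.Injective idx :=
    ⟨fun i => Fintype.equivFin ι i, Fin.val_injective.comp (Fintype.equivFin ι).injective⟩
  let tl : (Σ _ : ι, ℕ) → V := fun e =>
    if M.sec e.1 e.2 % 2 = 0 then T.vert e.1 e.2 else T.vert e.1 (e.2 + 1)
  let hd : (Σ _ : ι, ℕ) → V := fun e =>
    if M.sec e.1 e.2 % 2 = 0 then T.vert e.1 (e.2 + 1) else T.vert e.1 e.2
  have hs : ∀ e, s(tl e, hd e) = s(T.vert e.1 e.2, T.vert e.1 (e.2 + 1)) := by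
    intro e
    simp only [tl, hd]
    split_ifs
    · rfl
    · exact Sym2.eq_swap
  refine G.hasAntimagicOrientation_of_arcs T.edges tl hd ?_ ?_ ?_ (fun e => M.label idx e.1 e.2)
    (rankBy_injOn (M.edgeKey_injective hidx).injOn) ?_ ?_
  · rintro ⟨i, t⟩ he
    rw [← mem_edgeSet, hs]
    exact T.adj i t (T.mem_edges.1 he)
  · rintro ⟨i, t⟩ he ⟨j, t'⟩ he' h
    rw [hs, hs] at h
    obtain ⟨rfl, rfl⟩ := T.edge_inj i j t t' (T.mem_edges.1 he) (T.mem_edges.1 he') h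
    rfl
  · intro x y hxy
    obtain ⟨i, t, ht, h⟩ := T.edge_surj x y hxy
    exact ⟨⟨i, t⟩, T.mem_edges.2 ht, by rw [hs, h]⟩
  · exact fun e he => ⟨one_le_rankBy he, rankBy_le_card⟩
  -- Regularity makes the shift `d - 1` the same at every vertex, so injectivity passes from the
  -- marked contributions to the sums.
  · have hsum : ∀ u, ∑ e ∈ T.edges, ((if hd e = u then (M.label idx e.1 e.2 : ℤ) else 0) -
        if tl e = u then (M.label idx e.1 e.2 : ℤ) else 0) =
        M.visitSum idx (M.tour u) (M.pos u) - (d - 1) := by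
      intro u
      have hd' : #(T.visits (M.tour u) u) = d := by
        have := T.two_mul_card_visits (M.vert_pos u)
        rw [hG.degree_eq] at this
        omega
      rw [← hd', ← M.sum_visits_visitSum hidx u,
        ← T.sum_sum_visits (fun i t => M.visitSum idx i t) (M.vert_pos u), edges, sum_sigma]
      refine sum_congr rfl fun i _ => ?_
      simp only [visitSum, sub_eq_add_neg]
      rw [← T.sum_edges_eq_sum_visits i (fun t => -(M.sign i t * M.label idx i t))
        (fun t => M.sign i t * M.label idx i t) u]
      refine sum_congr rfl fun t _ => ?_
      simp only [tl, hd, sign]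
      by_cases hpar : M.sec i t % 2 = 0
      · simp only [hpar, if_true]
        split_ifs <;> ring
      · simp only [hpar, if_false]
        split_ifs <;> ring
    simp only [hsum]
    exact fun u v h => M.visitSum_pos_injective hidx (sub_left_injective h)

end SimpleGraph.EulerTours.Marking

theorem theorem3 {V : Type*} [Fintype V] (G : SimpleGraph V) [DecidableRel G.Adj]
    (d : ℕ) (hd : 2 ≤ d) (hG : G.IsRegularOfDegree (2 * d)) :
    G.HasAntimagicOrientation := by
  classical
  obtain ⟨T⟩ := G.exists_eulerTours (fun v => by rw [hG.degree_eq]; exact even_two_mul d)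
    (fun v => by rw [hG.degree_eq]; omega)
  obtain ⟨M⟩ := T.exists_marking (fun v => by rw [hG.degree_eq]; omega)
  exact M.hasAntimagicOrientation hG
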